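/- Let $(\Omega,\mathcal F,\mathbb P)$ be a probability space and $\alpha\in(0,1)$. Let $\lambda:[0,\infty)\to(0,\infty)$ be locally integrable with $\Lambda(t):=\int_0^t\lambda(\tau)\,d\tau\to\infty$ as $t\to\infty$. Let $(N_1(t))_{t\ge 0}$ be a standard (rate $1$) Poisson process and $N(t):=N_1(\Lambda(t))$. Let $(L_\alpha(t))_{t\ge0}$ be an $\alpha$-stable subordinator, i.e. a nondecreasing Lévy process with $\mathbb E[e^{-uL_\alpha(t)}]=e^{-tu^\alpha}$ for all $t,u\ge0$, with inverse $Y_\alpha(t):=\inf\{u\ge0: L_\alpha(u)>t\}$, and assume that $(Y_\alpha(t))_{t\ge0}$ and $(N(t))_{t\ge0}$ are independent. (The paths of $N_1$ and $L_\alpha$ are càdlàg, those of $N_1$ being nondecreasing and $\{0,1,2,\dots\}$-valued.) Let $N_\alpha(t):=N(Y_\alpha(t))$ be the fractional non-homogeneous Poisson process (FNPP), with the filtration $$\mathcal F_t:=\sigma(Y_\alpha(s): s\ge 0)\vee\sigma(N_\alpha(s): s\le t),\qquad t\ge0 .$$ Assume $\mathbb E[\Lambda(Y_\alpha(t))]<\infty$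 for every $t\ge0$. Then the FNPP has $(\mathcal F_t)$-compensator $A(t):=\Lambda(Y_\alpha(t))$. That is, $A$ is $(\mathcal F_t)$-predictable and almost surely starts at $0$ with nondecreasing right-continuous paths, and $$M(t):=N(Y_\alpha(t))-\Lambda(Y_\alpha(t)),\qquad t\ge0,$$ is an $(\mathcal F_t)$-martingale. -/

import Mathlib

open MeasureTheory ProbabilityTheory Filter Topology
open scoped NNReal

noncomputable section

namespace FNPP

variable {Ω : Type*} {m : MeasurableSpace Ω}

/-- Right-continuous with left limits, for functions on `[0, ∞)`. -/
def IsCadlag (f : ℝ≥0 → ℝ) : Prop :=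
  ∀ t, ContinuousWithinAt f (Set.Ici t) t ∧ ∃ l, Tendsto f (𝓝[<] t) (𝓝 l)

/-- A real-valued Lévy process: it starts at zero, has independent and stationary increments and
càdlàg paths. -/
structure IsLevyProcess (X : ℝ≥0 → Ω → ℝ) (P : Measure Ω) : Prop where
  measurable : ∀ t, Measurable (X t)
  zero : ∀ᵐ ω ∂P, X 0 ω = 0
  indep : HasIndepIncrements X P
  stationary : ∀ s h, IdentDistrib (fun ω => X (s + h) ω - X s ω) (X h) P P
  cadlag : ∀ ω, IsCadlag (fun t => X t ω)

/-- An `α`-stable subordinator: a nondecreasing Lévy process with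
`E[exp (-u L(t))] = exp (-t u ^ α)` for all `u ≥ 0`. -/
structure IsStableSubordinator (α : ℝ) (L : ℝ≥0 → Ω → ℝ) (P : Measure Ω) : Prop
    extends IsLevyProcess L P where
  mono : ∀ᵐ ω ∂P, Monotone (fun t => L t ω)
  laplace : ∀ (t : ℝ≥0) (u : ℝ), 0 ≤ u →
    ∫ ω, Real.exp (-u * L t ω) ∂P = Real.exp (-(t : ℝ) * u ^ α)

/-- A homogeneous Poisson process of rate `r`: a counting process starting at zero, with
independent increments and `N(t) - N(s)` Poisson distributed with parameter `r (t - s)`. -/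
structure IsPoissonProcess (r : ℝ≥0) (N : ℝ≥0 → Ω → ℕ) (P : Measure Ω) : Prop where
  measurable : ∀ t, Measurable (N t)
  mono : ∀ ω, Monotone (fun t => N t ω)
  rightCont : ∀ ω t, ContinuousWithinAt (fun s => N s ω) (Set.Ici t) t
  zero : ∀ᵐ ω ∂P, N 0 ω = 0
  indep : HasIndepIncrements N P
  law : ∀ s t, s ≤ t → HasLaw (fun ω => N t ω - N s ω) (poissonMeasure (r * (t - s))) P

/-- A rate function `λ : [0, ∞) → (0, ∞)`: locally integrable, with `∫₀ᵗ λ → ∞`.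
Values at negative arguments are irrelevant. -/
structure IsRate (lam : ℝ → ℝ) : Prop where
  pos : ∀ τ, 0 ≤ τ → 0 < lam τ
  locInt : LocallyIntegrableOn lam (Set.Ici 0) volume
  tendsto : Tendsto (fun t : ℝ => ∫ τ in (0 : ℝ)..t, lam τ) atTop atTop

/-- The cumulative rate `Λ(t) = ∫₀ᵗ λ(τ) dτ`. -/
def cumRate (lam : ℝ → ℝ) (t : ℝ≥0) : ℝ := ∫ τ in (0 : ℝ)..(t : ℝ), lam τ

/-- The non-homogeneous Poisson process `N(t) = N₁(Λ(t))`. Here `Λ(t) ≥ 0`, so that `toNNReal`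
only changes the type. -/
def nonhomPoisson (N₁ : ℝ≥0 → Ω → ℕ) (lam : ℝ → ℝ) (t : ℝ≥0) (ω : Ω) : ℕ :=
  N₁ (cumRate lam t).toNNReal ω

/-- The inverse subordinator `Y(t) = inf {u ≥ 0 : L(u) > t}`. -/
def inverseProcess (L : ℝ≥0 → Ω → ℝ) (t : ℝ≥0) (ω : Ω) : ℝ≥0 :=
  sInf {u : ℝ≥0 | (t : ℝ) < L u ω}

/-- The fractional non-homogeneous Poisson process `N_α(t) = N(Y_α(t))`. -/
def fnpp (N₁ : ℝ≥0 → Ω → ℕ) (lam : ℝ → ℝ) (L : ℝ≥0 → Ω → ℝ) (t : ℝ≥0) (ω : Ω) : ℕ :=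
  nonhomPoisson N₁ lam (inverseProcess L t ω) ω

/-- The filtration `F_t = σ(Y(s) : s ≥ 0) ∨ σ(X(s) : s ≤ t)`. -/
def historyFiltration (Y : ℝ≥0 → Ω → ℝ≥0) (X : ℝ≥0 → Ω → ℕ)
    (hY : ∀ t, Measurable (Y t)) (hX : ∀ t, Measurable (X t)) : Filtration ℝ≥0 m where
  seq t := (⨆ s, MeasurableSpace.comap (Y s) inferInstance) ⊔
    ⨆ s, ⨆ _ : s ≤ t, MeasurableSpace.comap (X s) inferInstance
  mono' _ _ hij := sup_le_sup le_rfl (biSup_mono fun _ h => h.trans hij)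
  le' _ := sup_le (iSup_le fun s => (hY s).comap_le) (iSup₂_le fun s _ => (hX s).comap_le)

/-- `A` is the compensator of the process `X` for the filtration `F`: a predictable process starting
at zero with nondecreasing right-continuous paths such that `X - A` is an `F`-martingale. -/
structure IsCompensator (X A : ℝ≥0 → Ω → ℝ) (F : Filtration ℝ≥0 m) (P : Measure Ω) : Prop where
  predictable : IsStronglyPredictable F A
  zero : ∀ᵐ ω ∂P, A 0 ω = 0
  mono : ∀ᵐ ω ∂P, Monotone (fun t => A t ω)
  rightCont : ∀ᵐ ω ∂P, ∀ t, ContinuousWithinAt (fun s => A s ω) (Set.Ici t) t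
  martingale : Martingale (fun t ω => X t ω - A t ω) F P

/-! Measurability facts, needed for the filtration to be one. -/

/-- A property that holds on a right neighbourhood of `t` holds at a point of the dense sequence
in `(t, b)`. -/
lemma exists_dense_right {p : ℝ≥0 → Prop} {t b : ℝ≥0} (htb : t < b)
    (h : ∀ᶠ s in 𝓝[≥] t, p s) :
    ∃ n, t < TopologicalSpace.denseSeq ℝ≥0 n ∧ TopologicalSpace.denseSeq ℝ≥0 n < b ∧
      p (TopologicalSpace.denseSeq ℝ≥0 n) := by
  obtain ⟨c, hc, hcs⟩ := (mem_nhdsGE_iff_exists_Ico_subset' htb).1 h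
  obtain ⟨x, ⟨n, rfl⟩, h1, h2⟩ :=
    (TopologicalSpace.denseRange_denseSeq ℝ≥0).exists_between (lt_min (Set.mem_Ioi.1 hc) htb)
  exact ⟨n, h1, h2.trans_le (min_le_right _ _), hcs ⟨h1.le, h2.trans_le (min_le_left _ _)⟩⟩

lemma measurable_inverseProcess {L : ℝ≥0 → Ω → ℝ} (hL : ∀ t, Measurable (L t))
    (hc : ∀ ω, IsCadlag (fun t => L t ω)) (t : ℝ≥0) : Measurable (inverseProcess L t) := by
  have key : ∀ ω u b, u < b → (t : ℝ) < L u ω → ∃ n, TopologicalSpace.denseSeq ℝ≥0 n < b ∧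
      (t : ℝ) < L (TopologicalSpace.denseSeq ℝ≥0 n) ω := by
    intro ω u b hub hu
    obtain ⟨n, -, h1, h2⟩ := exists_dense_right hub ((hc ω u).1.eventually (lt_mem_nhds hu))
    exact ⟨n, h1, h2⟩
  refine measurable_of_Iio fun x => ?_
  have : inverseProcess L t ⁻¹' Set.Iio x =
      (⋃ n, {ω | TopologicalSpace.denseSeq ℝ≥0 n < x ∧
        (t : ℝ) < L (TopologicalSpace.denseSeq ℝ≥0 n) ω}) ∪
      ({_ω | 0 < x} ∩ ⋂ n, {ω | L (TopologicalSpace.denseSeq ℝ≥0 n) ω ≤ t}) := by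
    ext ω
    simp only [Set.mem_preimage, Set.mem_Iio, Set.mem_union, Set.mem_iUnion, Set.mem_ofPred_eq,
      Set.mem_inter_iff, Set.mem_iInter, inverseProcess]
    constructor
    · intro h
      rcases Set.eq_empty_or_nonempty {u : ℝ≥0 | (t : ℝ) < L u ω} with he | hne
      · refine Or.inr ⟨pos_of_gt h, fun n => ?_⟩
        by_contra hn
        have : TopologicalSpace.denseSeq ℝ≥0 n ∈ {u : ℝ≥0 | (t : ℝ) < L u ω} := not_le.1 hn
        rw [he] at this
        exact this
      · obtain ⟨u, hu, hux⟩ := exists_lt_of_csInf_lt hne h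
        exact Or.inl (key ω u x hux hu)
    · rintro (⟨n, h1, h2⟩ | ⟨hx, h⟩)
      · exact lt_of_le_of_lt (csInf_le (s := {u : ℝ≥0 | (t : ℝ) < L u ω}) (OrderBot.bddBelow _) h2) h1
      · have : {u : ℝ≥0 | (t : ℝ) < L u ω} = ∅ := by
          refine Set.eq_empty_iff_forall_notMem.2 fun u hu => ?_
          obtain ⟨n, -, hn⟩ := key ω u (u + 1) (by simp) hu
          exact absurd (h n) (not_le.2 hn)
        rw [this]
        simpa using hx
  rw [this]
  refine .union (.iUnion fun n => ?_) (.inter (.const _) (.iInter fun n => ?_))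
  · exact .inter (.const _) (measurableSet_lt measurable_const (hL _))
  · exact measurableSet_le (hL _) measurable_const

lemma measurable_cumRate {lam : ℝ → ℝ} (h : IsRate lam) : Measurable (cumRate lam) := by
  have hint : ∀ a : ℝ≥0, IntervalIntegrable lam volume 0 (a : ℝ) := fun a =>
    (intervalIntegrable_iff_integrableOn_Icc_of_le a.2).2
      (h.locInt.integrableOn_compact_subset Set.Icc_subset_Ici_self isCompact_Icc)
  refine Monotone.measurable fun a b hab => ?_
  have h1 := intervalIntegral.integral_interval_sub_left (hint b) (hint a)
  have h2 : 0 ≤ ∫ τ in (a : ℝ)..b, lam τ :=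
    intervalIntegral.integral_nonneg (by exact_mod_cast hab)
      fun τ hτ => (h.pos τ (a.2.trans hτ.1)).le
  simp only [cumRate]
  linarith

lemma measurable_fnpp {r : ℝ≥0} {N₁ : ℝ≥0 → Ω → ℕ} {lam : ℝ → ℝ} {L : ℝ≥0 → Ω → ℝ}
    {P : Measure Ω} (hN : IsPoissonProcess r N₁ P) (hlam : IsRate lam)
    (hY : ∀ t, Measurable (inverseProcess L t)) (t : ℝ≥0) : Measurable (fnpp N₁ lam L t) := by
  set T : Ω → ℝ≥0 := fun ω => (cumRate lam (inverseProcess L t ω)).toNNReal with hT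
  have hTm : Measurable T := ((measurable_cumRate hlam).comp (hY t)).real_toNNReal
  refine measurable_of_Iic fun k => ?_
  have : fnpp N₁ lam L t ⁻¹' Set.Iic k = ⋃ n, {ω | T ω < TopologicalSpace.denseSeq ℝ≥0 n} ∩
      {ω | N₁ (TopologicalSpace.denseSeq ℝ≥0 n) ω ≤ k} := by
    ext ω
    simp only [Set.mem_preimage, Set.mem_Iic, Set.mem_iUnion, Set.mem_inter_iff, Set.mem_ofPred_eq]
    change N₁ (T ω) ω ≤ k ↔ _
    constructor
    · intro h
      obtain ⟨n, h1, -, h2⟩ := exists_dense_right (b := T ω + 1) (by simp)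
        ((hN.rightCont ω (T ω)).eventually ((isOpen_discrete (Set.Iic k)).mem_nhds h))
      exact ⟨n, h1, h2⟩
    · rintro ⟨n, h1, h2⟩
      exact (hN.mono ω h1.le).trans h2
  rw [this]
  exact .iUnion fun n => .inter (measurableSet_lt hTm measurable_const)
    (measurableSet_le (hN.measurable _) measurable_const)

/-- The filtration `F_t = σ(Y_α(s) : s ≥ 0) ∨ σ(N_α(s) : s ≤ t)` of the fractional
non-homogeneous Poisson process. -/
def fnppFiltration {α : ℝ} {N₁ : ℝ≥0 → Ω → ℕ} {lam : ℝ → ℝ} {L : ℝ≥0 → Ω → ℝ} {P : Measure Ω}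
    (hL : IsStableSubordinator α L P) (hN : IsPoissonProcess 1 N₁ P) (hlam : IsRate lam) :
    Filtration ℝ≥0 m :=
  historyFiltration (inverseProcess L) (fnpp N₁ lam L)
    (measurable_inverseProcess hL.measurable hL.cadlag)
    (measurable_fnpp hN hlam (measurable_inverseProcess hL.measurable hL.cadlag))

end FNPP

end

namespace FNPP

/-! The initial σ-algebra already contains the whole path of `Y`, so given that path the clock `u ↦
Λ(Y u)` is deterministic. It is nondecreasing for almost every path, so `N₁` run along it has
independent Poisson increments with mean `Λ(Y t) - Λ(Y s)`. Independence of `Y` and `N` makes this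
rigorous through Fubini (`lintegral_of_indepFun`). An event at time `s` is a condition on `Y` and on
`N_α` up to `s`; with `Y` frozen it concerns `N₁` only up to time `Λ(Y s)`, hence is independent of
the next increment (`IsPoissonProcess.indepFun_past`). The expectation factorises, and integrating
over `Y` gives `setLIntegral_fnpp_increment`, which is the martingale property once integrability is
known. Predictability holds because `A` is jointly measurable in time and the initial σ-algebra. The
Laplace transform yields the path properties of `Y`: `L` is unbounded, so `Y` is monotone, and `L`
is positive at positive times, so `Y 0 = 0`. -/

/-! ### Right-continuous processes -/

/-- The approximation of `t` from the right by a point of the grid of mesh `1 / (n + 1)`. -/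
noncomputable def rightGrid (n : ℕ) (t : ℝ≥0) : ℝ≥0 :=
  ((⌊t * (n + 1)⌋₊ : ℝ≥0) + 1) / (n + 1)

lemma le_rightGrid (n : ℕ) (t : ℝ≥0) : t ≤ rightGrid n t := by
  rw [rightGrid, le_div_iff₀ (by positivity)]
  exact (Nat.lt_floor_add_one _).le

lemma rightGrid_le (n : ℕ) (t : ℝ≥0) : rightGrid n t ≤ t + 1 / (n + 1) := by
  have h : (0 : ℝ≥0) < n + 1 := by positivity
  rw [rightGrid, add_div]
  gcongr
  rw [div_le_iff₀ h]
  exact Nat.floor_le zero_le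

lemma tendsto_rightGrid (t : ℝ≥0) : Tendsto (fun n => rightGrid n t) atTop (𝓝[≥] t) := by
  refine tendsto_nhdsWithin_iff.2 ⟨?_, .of_forall fun n => le_rightGrid n t⟩
  refine tendsto_of_tendsto_of_tendsto_of_le_of_le tendsto_const_nhds ?_
    (fun n => le_rightGrid n t) (fun n => rightGrid_le n t)
  simpa using tendsto_const_nhds.add (tendsto_one_div_add_atTop_nhds_zero_nat (𝕜 := ℝ≥0))

/-- A process with right-continuous paths is jointly measurable. -/
lemma measurable_uncurry_of_rightCont {Ω E : Type*} {_ : MeasurableSpace Ω}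
    [TopologicalSpace E] [TopologicalSpace.PseudoMetrizableSpace E] [MeasurableSpace E]
    [BorelSpace E] {X : ℝ≥0 → Ω → E} (hX : ∀ t, Measurable (X t))
    (hc : ∀ ω t, ContinuousWithinAt (fun s => X s ω) (Set.Ici t) t) :
    Measurable (Function.uncurry X) := by
  refine measurable_of_tendsto_metrizable
    (f := fun (n : ℕ) (p : ℝ≥0 × Ω) => X (rightGrid n p.1) p.2) (fun n => ?_) ?_
  -- The grid approximation sees time only through a natural number, so joint measurability is a
  -- countable matter.
  · have h : Measurable fun p : ℕ × Ω => X (((p.1 : ℝ≥0) + 1) / (n + 1)) p.2 :=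
      measurable_from_prod_countable_right fun k => hX (((k : ℝ≥0) + 1) / (n + 1))
    exact h.comp (f := fun p : ℝ≥0 × Ω => (⌊p.1 * (n + 1)⌋₊, p.2)) <|
      (Nat.measurable_floor.comp (measurable_fst.mul_const _)).prodMk measurable_snd
  · refine tendsto_pi_nhds.2 fun p => ?_
    exact (hc p.2 p.1).tendsto.comp (tendsto_rightGrid p.1)

/-- Borel functions of time and of the initial σ-algebra are predictable. -/
lemma prod_le_predictable {Ω : Type*} {m : MeasurableSpace Ω} (F : Filtration ℝ≥0 m) :
    (inferInstance : MeasurableSpace ℝ≥0).prod (F 0) ≤ F.predictable := by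
  refine sup_le ?_ ?_
  · rw [BorelSpace.measurable_eq (α := ℝ≥0), borel_eq_generateFrom_Ioi,
      MeasurableSpace.comap_generateFrom]
    refine MeasurableSpace.generateFrom_le ?_
    rintro _ ⟨_, ⟨a, rfl⟩, rfl⟩
    have : (Prod.fst : ℝ≥0 × Ω → ℝ≥0) ⁻¹' Set.Ioi a = Set.Ioi a ×ˢ Set.univ := by
      ext; simp
    rw [this]
    exact measurableSet_predictable_Ioi_prod MeasurableSet.univ
  · rintro _ ⟨B, hB, rfl⟩
    -- Both pieces are generators of the predictable σ-algebra because `B` is known at time `0`.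
    have : (Prod.snd : ℝ≥0 × Ω → Ω) ⁻¹' B = {⊥} ×ˢ B ∪ Set.Ioi 0 ×ˢ B := by
      ext p
      have : p.1 = ⊥ ∨ 0 < p.1 := by
        rw [NNReal.bot_eq_zero]; exact eq_zero_or_pos p.1
      simp only [Set.mem_preimage, Set.mem_union, Set.mem_prod, Set.mem_singleton_iff, Set.mem_Ioi]
      tauto
    rw [this]
    exact @MeasurableSet.union _ F.predictable _ _ (measurableSet_predictable_singleton_bot_prod hB)
      (measurableSet_predictable_Ioi_prod hB)

/-! ### The cumulative rate -/

lemma IsRate.intervalIntegrable {lam : ℝ → ℝ} (h : IsRate lam) (a : ℝ≥0) :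
    IntervalIntegrable lam volume 0 (a : ℝ) :=
  (intervalIntegrable_iff_integrableOn_Icc_of_le a.2).2
    (h.locInt.integrableOn_compact_subset Set.Icc_subset_Ici_self isCompact_Icc)

@[simp] lemma cumRate_zero (lam : ℝ → ℝ) : cumRate lam 0 = 0 := by simp [cumRate]

lemma monotone_cumRate {lam : ℝ → ℝ} (h : IsRate lam) : Monotone (cumRate lam) := by
  intro a b hab
  have h1 := intervalIntegral.integral_interval_sub_left (h.intervalIntegrable b)
    (h.intervalIntegrable a)
  have h2 : 0 ≤ ∫ τ in (a : ℝ)..b, lam τ :=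
    intervalIntegral.integral_nonneg (by exact_mod_cast hab)
      fun τ hτ => (h.pos τ (a.2.trans hτ.1)).le
  simp only [cumRate]
  linarith

lemma cumRate_nonneg {lam : ℝ → ℝ} (h : IsRate lam) (a : ℝ≥0) : 0 ≤ cumRate lam a := by
  simpa using monotone_cumRate h zero_le

lemma continuous_cumRate {lam : ℝ → ℝ} (h : IsRate lam) : Continuous (cumRate lam) := by
  refine continuous_iff_continuousAt.2 fun a => ?_
  have h1 : ContinuousOn (fun x : ℝ => ∫ τ in (0 : ℝ)..x, lam τ)
      (Set.uIcc 0 ((a + 1 : ℝ≥0) : ℝ)) :=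
    intervalIntegral.continuousOn_primitive_interval' (h.intervalIntegrable (a + 1))
      Set.left_mem_uIcc
  rw [Set.uIcc_of_le (NNReal.coe_nonneg _)] at h1
  have h2 : ContinuousOn (cumRate lam) (Set.Iic (a + 1)) :=
    h1.comp NNReal.continuous_coe.continuousOn fun x hx => ⟨x.2, by exact_mod_cast hx⟩
  exact h2.continuousAt (Iic_mem_nhds (by simp))

/-! ### The inverse of a subordinator -/

section Inverse

variable {Ω : Type*} {m : MeasurableSpace Ω} {L : ℝ≥0 → Ω → ℝ}

/-- The sets `{u | t < L u}` shrink as `t` grows, and by strictness each member survives a small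
increase of `t`. No regularity of `L` is involved, so this holds for every `ω`. -/
lemma rightCont_inverseProcess (L : ℝ≥0 → Ω → ℝ) (ω : Ω) (t : ℝ≥0) :
    ContinuousWithinAt (fun s => inverseProcess L s ω) (Set.Ici t) t := by
  rcases Set.eq_empty_or_nonempty {u : ℝ≥0 | (t : ℝ) < L u ω} with he | hne
  -- An empty set stays empty to the right of `t`, and `sInf ∅ = 0` in `ℝ≥0`.
  · refine continuousWithinAt_const.congr (f := fun _ => 0) (fun s hs => ?_) ?_
    · have : {u : ℝ≥0 | (s : ℝ) < L u ω} = ∅ := by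
        refine Set.subset_empty_iff.1 (he ▸ fun u hu => ?_)
        exact lt_of_le_of_lt (NNReal.coe_le_coe.2 hs) hu
      simp [inverseProcess, this]
    · simp [inverseProcess, he]
  · refine tendsto_order.2 ⟨fun a ha => ?_, fun b hb => ?_⟩
    · obtain ⟨u, hu⟩ := hne
      have hu' : ∀ᶠ s : ℝ≥0 in 𝓝 t, (s : ℝ) < L u ω :=
        NNReal.continuous_coe.continuousAt.eventually_lt continuousAt_const hu
      filter_upwards [nhdsWithin_le_nhds hu', self_mem_nhdsWithin] with s hs hts
      refine ha.trans_le (csInf_le_csInf (OrderBot.bddBelow _) ⟨u, hs⟩ fun v hv => ?_)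
      exact lt_of_le_of_lt (NNReal.coe_le_coe.2 hts) hv
    · obtain ⟨u, hu, hub⟩ := exists_lt_of_csInf_lt hne hb
      have hu' : ∀ᶠ s : ℝ≥0 in 𝓝 t, (s : ℝ) < L u ω :=
        NNReal.continuous_coe.continuousAt.eventually_lt continuousAt_const hu
      filter_upwards [nhdsWithin_le_nhds hu'] with s hs
      exact lt_of_le_of_lt (csInf_le (OrderBot.bddBelow _) hs) hub

/-- Unboundedness rules out the empty set, whose infimum `0` would make the path drop. -/
lemma monotone_inverseProcess {ω : Ω} (h : ∀ c : ℝ, ∃ u, c < L u ω) :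
    Monotone fun t => inverseProcess L t ω := fun _ t hst =>
  csInf_le_csInf (OrderBot.bddBelow _) (h t) fun _ hv =>
    lt_of_le_of_lt (NNReal.coe_le_coe.2 hst) hv

lemma inverseProcess_zero {ω : Ω} (h : ∀ n : ℕ, 0 < L (1 / (n + 1)) ω) :
    inverseProcess L 0 ω = 0 := by
  refine le_antisymm (le_of_forall_pos_le_add fun ε hε => ?_) zero_le
  obtain ⟨n, hn⟩ := exists_nat_one_div_lt (K := ℝ≥0) hε
  rw [zero_add]
  refine (csInf_le (OrderBot.bddBelow _) ?_).trans hn.le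
  simpa using h n

variable {P : Measure Ω} {α : ℝ}

/-- Chernoff's bound: on the event, `1 ≤ exp (u * c) * exp (-u * L t)`. -/
lemma IsStableSubordinator.measure_le (hL : IsStableSubordinator α L P) (t : ℝ≥0) {u : ℝ}
    (hu : 0 ≤ u) (c : ℝ) :
    P {ω | L t ω ≤ c} ≤ ENNReal.ofReal (Real.exp (u * c) * Real.exp (-(t : ℝ) * u ^ α)) := by
  have hi : Integrable (fun ω => Real.exp (-u * L t ω)) P := by
    -- A non-integrable function has Bochner integral `0`, whereas the Laplace transform is
    -- positive.
    by_contra h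
    have := hL.laplace t u hu
    rw [integral_undef h] at this
    exact (Real.exp_pos _).ne this
  have h1 : P {ω | L t ω ≤ c} ≤
      ∫⁻ ω, ENNReal.ofReal (Real.exp (u * c) * Real.exp (-u * L t ω)) ∂P := by
    rw [← lintegral_indicator_one (measurableSet_le (hL.measurable t) measurable_const)]
    refine lintegral_mono fun ω => ?_
    rw [Set.indicator_apply]
    split_ifs with hω
    swap
    · exact zero_le
    have hω : L t ω ≤ c := hω
    rw [← Real.exp_add, Pi.one_apply, ENNReal.one_le_ofReal, Real.one_le_exp_iff]
    nlinarith
  refine h1.trans ?_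
  rw [← ofReal_integral_eq_lintegral_ofReal (hi.const_mul _)
    (.of_forall fun ω => by positivity), integral_const_mul, hL.laplace t u hu]

/-- Chernoff with `u = 1` gives `P (L n ≤ k) ≤ exp (k - n)`, which vanishes as `n → ∞`. -/
lemma IsStableSubordinator.ae_unbounded (hL : IsStableSubordinator α L P) :
    ∀ᵐ ω ∂P, ∀ c : ℝ, ∃ u, c < L u ω := by
  have key : ∀ k : ℕ, ∀ᵐ ω ∂P, ∃ u, (k : ℝ) < L u ω := by
    intro k
    have hz : P {ω | ∀ n : ℕ, L n ω ≤ k} = 0 := by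
      refine le_antisymm (ge_of_tendsto' (x := atTop) (f := fun n : ℕ => ENNReal.ofReal
        (Real.exp (1 * k) * Real.exp (-((n : ℝ≥0) : ℝ) * 1 ^ α))) ?_ fun n => ?_) zero_le
      · rw [← ENNReal.ofReal_zero]
        refine (ENNReal.continuous_ofReal.tendsto _).comp ?_
        rw [← mul_zero (Real.exp (1 * k))]
        refine Tendsto.const_mul _ (Real.tendsto_exp_atBot.comp ?_)
        simpa [Function.comp_def] using
        tendsto_neg_atTop_atBot.comp (tendsto_natCast_atTop_atTop (R := ℝ))
      · exact (measure_mono (Set.ofPred_subset_ofPred.2 fun ω hω => hω n)).trans (hL.measure_le n zero_le_one k)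
    filter_upwards [measure_eq_zero_iff_ae_notMem.1 hz] with ω hω
    simp only [not_forall, not_le] at hω
    exact ⟨_, hω.choose_spec⟩
  filter_upwards [ae_all_iff.2 key] with ω hω c
  obtain ⟨k, hk⟩ := exists_nat_ge c
  exact (hω k).imp fun u hu => hk.trans_lt hu

/-- Chernoff with `c = 0` and `u → ∞`; positivity of `α` makes `u ^ α` diverge. -/
lemma IsStableSubordinator.ae_pos (hL : IsStableSubordinator α L P) (hα : 0 < α) {t : ℝ≥0}
    (ht : 0 < t) : ∀ᵐ ω ∂P, 0 < L t ω := by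
  have hz : P {ω | L t ω ≤ 0} = 0 := by
    refine le_antisymm (ge_of_tendsto (x := atTop) (f := fun u : ℝ => ENNReal.ofReal
      (Real.exp (u * 0) * Real.exp (-(t : ℝ) * u ^ α))) ?_ ?_) zero_le
    · rw [← ENNReal.ofReal_zero]
      refine (ENNReal.continuous_ofReal.tendsto _).comp ?_
      simp only [mul_zero, Real.exp_zero, one_mul]
      refine Real.tendsto_exp_atBot.comp ?_
      exact (tendsto_rpow_atTop hα).const_mul_atTop_of_neg (by simpa using ht)
    · filter_upwards [eventually_ge_atTop 0] with u hu
      exact hL.measure_le t hu 0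
  filter_upwards [measure_eq_zero_iff_ae_notMem.1 hz] with ω hω
  simpa using hω

lemma IsStableSubordinator.ae_monotone_inverse (hL : IsStableSubordinator α L P) :
    ∀ᵐ ω ∂P, Monotone fun t => inverseProcess L t ω :=
  hL.ae_unbounded.mono fun _ => monotone_inverseProcess

lemma IsStableSubordinator.ae_inverse_zero (hL : IsStableSubordinator α L P) (hα : 0 < α) :
    ∀ᵐ ω ∂P, inverseProcess L 0 ω = 0 := by
  have : ∀ n : ℕ, ∀ᵐ ω ∂P, 0 < L (1 / (n + 1)) ω := fun n => hL.ae_pos hα (by positivity)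
  filter_upwards [ae_all_iff.2 this] with ω hω
  exact inverseProcess_zero hω

end Inverse

/-! ### Poisson processes -/

lemma lintegral_id_poissonMeasure (r : ℝ≥0) :
    ∫⁻ n, (n : ENNReal) ∂poissonMeasure r = r := by
  have h := (hasSum_one_poissonMeasure r).mul_left (r : ℝ)
  have h2 : ∑' n : ℕ, ENNReal.ofReal (r * (Real.exp (-r) * r ^ n / n.factorial)) = r := by
    rw [← ENNReal.ofReal_tsum_of_nonneg (fun n => by positivity) h.summable, h.tsum_eq, mul_one,
      ENNReal.ofReal_coe_nnreal]
  -- The size-bias identity `(n + 1) p (n + 1) = r * p n` for Poisson weights `p`, which reduces the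
  -- mean to the total mass.
  have h3 : ∀ n : ℕ, ENNReal.ofReal (Real.exp (-r) * r ^ (n + 1) / (n + 1).factorial) *
      ((n + 1 : ℕ) : ENNReal) = ENNReal.ofReal (r * (Real.exp (-r) * r ^ n / n.factorial)) := by
    intro n
    rw [← ENNReal.ofReal_natCast, ← ENNReal.ofReal_mul (by positivity), Nat.factorial_succ]
    congr 1
    push_cast
    field_simp
    ring
  have h4 : ∀ n : ℕ, ∫⁻ k, (k : ENNReal) ∂(ENNReal.ofReal (Real.exp (-r) * r ^ n / n.factorial) •
      Measure.dirac n) = ENNReal.ofReal (Real.exp (-r) * r ^ n / n.factorial) * n := by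
    intro n
    rw [lintegral_smul_measure, lintegral_dirac, smul_eq_mul]
  rw [poissonMeasure, lintegral_sum_measure, ← h2, tsum_congr h4]
  refine (tsum_eq_zero_add' ENNReal.summable).trans ?_
  rw [tsum_congr h3, Nat.cast_zero, mul_zero, zero_add]

section Poisson

variable {Ω : Type*} {m : MeasurableSpace Ω} {P : Measure Ω} {r : ℝ≥0} {N : ℝ≥0 → Ω → ℕ}

lemma IsPoissonProcess.lintegral_increment (hN : IsPoissonProcess r N P) {s t : ℝ≥0}
    (hst : s ≤ t) : ∫⁻ ω, ((N t ω - N s ω : ℕ) : ENNReal) ∂P = (r * (t - s) : ℝ≥0) := by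
  rw [(hN.law s t hst).lintegral_comp (f := fun n : ℕ => (n : ENNReal)) (by fun_prop),
    lintegral_id_poissonMeasure]

/-- The increments of a Poisson process are independent of finitely many past values. -/
lemma IsPoissonProcess.indepFun_finset (hN : IsPoissonProcess r N P) {s t : ℝ≥0} (hst : s ≤ t)
    {ι : Type*} [Finite ι] {τ : ι → ℝ≥0} (hτ : ∀ i, τ i ≤ s) :
    IndepFun (fun ω i => N (τ i) ω) (fun ω => N t ω - N s ω) P := by
  classical
  cases nonempty_fintype ι
  set J : Finset ℝ≥0 := insert s (Finset.univ.image τ) with hJ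
  have hJs : ∀ x ∈ J, x ≤ s := by
    intro x hx
    simp only [hJ, Finset.mem_insert, Finset.mem_image, Finset.mem_univ, true_and] at hx
    rcases hx with rfl | ⟨i, rfl⟩
    exacts [le_rfl, hτ i]
  set e := J.orderIsoOfFin rfl
  -- The sequence is `0`, then the points of `J` in increasing order, then `t` forever. The last
  -- point of `J` is `s`, so the increment of index `J.card` is the one from `s` to `t`.
  set σ : ℕ → ℝ≥0 := fun k =>
    if k = 0 then 0 else if h : k - 1 < J.card then (e ⟨k - 1, h⟩ : ℝ≥0) else t with hσ
  have hσe : ∀ k (h : k < J.card), σ (k + 1) = e ⟨k, h⟩ := fun k h => by simp [hσ, h]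
  have hσt : ∀ k, J.card ≤ k → σ (k + 1) = t := fun k h => by simp [hσ, h]
  have hidx : ∀ x ∈ J, ∃ k, k < J.card ∧ σ (k + 1) = x := fun x hx =>
    ⟨e.symm ⟨x, hx⟩, (e.symm ⟨x, hx⟩).2, by rw [hσe _ (e.symm ⟨x, hx⟩).2]; simp⟩
  have hmono : Monotone σ := by
    refine monotone_nat_of_le_succ fun k => ?_
    rcases k with _ | k
    · simp [hσ]
    · rcases lt_or_ge (k + 1) J.card with h | h
      · rw [hσe _ h, hσe k (by omega)]
        exact e.monotone (by simp)
      · rw [hσt _ h]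
        rcases lt_or_ge k J.card with h' | h'
        · rw [hσe _ h']
          exact (hJs _ (e _).2).trans hst
        · rw [hσt _ h']
  have hpos : 0 < J.card := Finset.card_pos.2 ⟨s, by simp [hJ]⟩
  have hlast : σ J.card = s := by
    obtain ⟨k, hk, hks⟩ := hidx s (by simp [hJ])
    refine le_antisymm ?_ (hks ▸ hmono hk)
    obtain ⟨n, hn⟩ := Nat.exists_eq_succ_of_ne_zero hpos.ne'
    rw [hn, Nat.succ_eq_add_one, hσe n (by omega)]
    exact hJs _ (e _).2
  choose k hk hkτ using fun i => hidx (τ i) (by simp [hJ])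
  have hind := (hN.indep.nat hmono).indepFun_finset (Finset.range J.card) {J.card} (by simp)
    fun i => (hN.measurable _).sub (hN.measurable _)
  -- Past values are telescoping sums of the increments of index below `J.card`; the default `0` is
  -- never reached since `k i < J.card`. They agree only almost surely, as `N 0 = 0` does.
  have hcomp := hind.comp
    (φ := fun g i => ∑ j ∈ Finset.range (k i + 1),
      if h : j ∈ Finset.range J.card then g ⟨j, h⟩ else 0)
    (ψ := fun g => g ⟨J.card, by simp⟩) .of_discrete .of_discrete
  refine hcomp.congr ?_ ?_
  · filter_upwards [hN.zero] with ω hω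
    funext i
    have hm : Monotone fun j => N (σ j) ω := fun a b hab => hN.mono ω (hmono hab)
    have h0 : N (σ 0) ω = 0 := by simpa [hσ] using hω
    have := Finset.sum_range_tsub hm (k i + 1)
    rw [h0, hkτ, Nat.sub_zero] at this
    rw [← this]
    refine Finset.sum_congr rfl fun j hj => ?_
    have := hk i
    have hj' : j ∈ Finset.range J.card := by
      rw [Finset.mem_range] at hj ⊢
      omega
    rw [dif_pos hj']
  · refine .of_forall fun ω => ?_
    simp [Function.comp, hlast, hσt _ le_rfl]

/-- The increments of a Poisson process are independent of the past. -/
lemma IsPoissonProcess.indepFun_past [IsProbabilityMeasure P] (hN : IsPoissonProcess r N P)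
    {s t : ℝ≥0} (hst : s ≤ t) {ι : Type*} {τ : ι → ℝ≥0} (hτ : ∀ i, τ i ≤ s) :
    IndepFun (fun ω i => N (τ i) ω) (fun ω => N t ω - N s ω) P :=
  IndepFun.process_indepFun (X := fun i => N (τ i)) (fun _ => hN.measurable _)
    ((hN.measurable _).sub (hN.measurable _))
    fun I => hN.indepFun_finset hst (τ := fun i : I => τ i) fun _ => hτ _

/-! ### The non-homogeneous Poisson process -/

variable {lam : ℝ → ℝ}

lemma monotone_time (hlam : IsRate lam) : Monotone fun t => (cumRate lam t).toNNReal :=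
  fun _ _ h => Real.toNNReal_mono (monotone_cumRate hlam h)

lemma monotone_nonhomPoisson (hN : IsPoissonProcess r N P) (hlam : IsRate lam) (ω : Ω) :
    Monotone fun t => nonhomPoisson N lam t ω :=
  (hN.mono ω).comp (monotone_time hlam)

lemma rightCont_nonhomPoisson (hN : IsPoissonProcess r N P) (hlam : IsRate lam) (ω : Ω)
    (t : ℝ≥0) : ContinuousWithinAt (fun s => nonhomPoisson N lam s ω) (Set.Ici t) t :=
  ContinuousWithinAt.comp (g := fun s => N s ω) (f := fun s => (cumRate lam s).toNNReal)
    (t := Set.Ici (cumRate lam t).toNNReal) (hN.rightCont ω _)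
    (continuous_real_toNNReal.comp (continuous_cumRate hlam)).continuousWithinAt
    fun _ hs => monotone_time hlam hs

lemma lintegral_nonhomPoisson_increment (hN : IsPoissonProcess 1 N P) (hlam : IsRate lam)
    {s t : ℝ≥0} (hst : s ≤ t) :
    ∫⁻ ω, ((nonhomPoisson N lam t ω - nonhomPoisson N lam s ω : ℕ) : ENNReal) ∂P =
      ENNReal.ofReal (cumRate lam t - cumRate lam s) := by
  have := hN.lintegral_increment (monotone_time hlam hst)
  have h2 : ENNReal.ofReal (cumRate lam t - cumRate lam s) =
      ((1 * ((cumRate lam t).toNNReal - (cumRate lam s).toNNReal) : ℝ≥0) : ENNReal) := by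
    rw [ENNReal.ofReal_sub _ (cumRate_nonneg hlam s), one_mul, ENNReal.coe_sub]
    rfl
  exact this.trans h2.symm

end Poisson

/-! ### Evaluation of a right-continuous path at a random time -/

/-- The infimum of the values of a path at the points of the dense sequence after `x`. -/
noncomputable def rightValue (x : ℝ≥0) (f : ℝ≥0 → ℕ) : ℕ :=
  sInf {j | ∃ k, x < TopologicalSpace.denseSeq ℝ≥0 k ∧ f (TopologicalSpace.denseSeq ℝ≥0 k) = j}

lemma rightValue_nonempty (x : ℝ≥0) (f : ℝ≥0 → ℕ) :
    {j | ∃ k, x < TopologicalSpace.denseSeq ℝ≥0 k ∧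
      f (TopologicalSpace.denseSeq ℝ≥0 k) = j}.Nonempty := by
  obtain ⟨k, hk, -⟩ := exists_dense_right (p := fun _ => True) (lt_add_one x) (by simp)
  exact ⟨_, k, hk, rfl⟩

lemma rightValue_le_iff {x : ℝ≥0} {f : ℝ≥0 → ℕ} {j : ℕ} :
    rightValue x f ≤ j ↔ ∃ k, x < TopologicalSpace.denseSeq ℝ≥0 k ∧
      f (TopologicalSpace.denseSeq ℝ≥0 k) ≤ j := by
  constructor
  · intro h
    obtain ⟨k, hk, hkj⟩ := Nat.sInf_mem (rightValue_nonempty x f)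
    exact ⟨k, hk, hkj.le.trans h⟩
  · rintro ⟨k, hk, hkj⟩
    refine le_trans (Nat.sInf_le ?_) hkj
    exact ⟨k, hk, rfl⟩

lemma rightValue_eq {f : ℝ≥0 → ℕ} {x : ℝ≥0} (hf : Monotone f)
    (hc : ContinuousWithinAt f (Set.Ici x) x) : rightValue x f = f x := by
  refine eq_of_forall_ge_iff fun j => rightValue_le_iff.trans ⟨?_, fun h => ?_⟩
  · rintro ⟨k, hk, hkj⟩
    exact (hf hk.le).trans hkj
  · obtain ⟨k, h1, -, h2⟩ := exists_dense_right (lt_add_one x)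
      (hc.eventually ((isOpen_discrete (Set.Iic j)).mem_nhds h))
    exact ⟨k, h1, h2⟩

/-- Evaluation `(x, f) ↦ f x` involves uncountably many coordinates and is not measurable for the
product σ-algebra. `rightValue` consults countably many, and by `rightValue_eq` it is evaluation on
monotone right-continuous paths. -/
lemma measurable_rightValue :
    Measurable fun p : ℝ≥0 × (ℝ≥0 → ℕ) => rightValue p.1 p.2 := by
  refine measurable_of_Iic fun j => ?_
  have : (fun p : ℝ≥0 × (ℝ≥0 → ℕ) => rightValue p.1 p.2) ⁻¹' Set.Iic j =
      ⋃ k, {p | p.1 < TopologicalSpace.denseSeq ℝ≥0 k} ∩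
        {p | p.2 (TopologicalSpace.denseSeq ℝ≥0 k) ≤ j} := by
    ext p
    simp [rightValue_le_iff]
  rw [this]
  exact .iUnion fun k => .inter (measurableSet_lt measurable_fst measurable_const)
    (measurableSet_le ((measurable_pi_apply _).comp measurable_snd) measurable_const)

/-- Fubini's theorem for two independent random elements. -/
lemma lintegral_of_indepFun {Ω S T : Type*} {m : MeasurableSpace Ω} [MeasurableSpace S]
    [MeasurableSpace T] {P : Measure Ω} [IsFiniteMeasure P] {U : Ω → S} {V : Ω → T}
    (h : IndepFun U V P) (hU : Measurable U) (hV : Measurable V) {F : S × T → ENNReal}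
    (hF : Measurable F) :
    ∫⁻ ω, F (U ω, V ω) ∂P = ∫⁻ ω, ∫⁻ ω', F (U ω, V ω') ∂P ∂P := by
  rw [← lintegral_map hF (hU.prodMk hV), h.map_prod_eq_prod_map_map hU.aemeasurable hV.aemeasurable,
    lintegral_prod _ hF.aemeasurable, lintegral_map hF.lintegral_prod_right' hU]
  refine lintegral_congr fun ω => ?_
  exact lintegral_map (f := fun y => F (U ω, y)) (hF.comp measurable_prodMk_left) hV

/-! ### The martingale property -/

section Main

variable {Ω : Type*} {m : MeasurableSpace Ω} {P : Measure Ω} {α : ℝ}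
  {lam : ℝ → ℝ} {N₁ : ℝ≥0 → Ω → ℕ} {L : ℝ≥0 → Ω → ℝ}

/-- The sets of the history at time `t` are events in terms of the random times and of the process
up to time `t`. -/
lemma exists_of_measurableSet_historyFiltration {Y : ℝ≥0 → Ω → ℝ≥0} {X : ℝ≥0 → Ω → ℕ}
    {hY : ∀ t, Measurable (Y t)} {hX : ∀ t, Measurable (X t)} {t : ℝ≥0} {A : Set Ω}
    (hA : MeasurableSet[historyFiltration Y X hY hX t] A) :
    ∃ B : Set ((ℝ≥0 → ℝ≥0) × (Set.Iic t → ℕ)), MeasurableSet B ∧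
      (fun ω => (fun s => Y s ω, fun s : Set.Iic t => X s ω)) ⁻¹' B = A := by
  set Z : Ω → (ℝ≥0 → ℝ≥0) × (Set.Iic t → ℕ) :=
    fun ω => (fun s => Y s ω, fun s : Set.Iic t => X s ω)
  have hZ : Measurable[MeasurableSpace.comap Z inferInstance] Z := comap_measurable Z
  have hle : historyFiltration Y X hY hX t ≤ MeasurableSpace.comap Z inferInstance := by
    refine sup_le (iSup_le fun s => ?_) (iSup₂_le fun s hs => ?_)
    · exact (((measurable_pi_apply s).comp measurable_fst).comp hZ).comap_le
    · exact (((measurable_pi_apply (⟨s, hs⟩ : Set.Iic t)).comp measurable_snd).comp hZ).comap_le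
  exact hle A hA

lemma indicator_preimage_eq_mul {S : Type*} (Z : Ω → S) (B : Set S) (g : Ω → ENNReal) (ω : Ω) :
    (Z ⁻¹' B).indicator g ω = B.indicator 1 (Z ω) * g ω := by
  classical
  simp only [Set.indicator_apply, Set.mem_preimage]
  split_ifs <;> simp

/-- On the events of the past at time `s`, the increments of the fractional process and of its
compensator have the same mean. -/
lemma setLIntegral_fnpp_increment [IsProbabilityMeasure P] (hlam : IsRate lam) (hN : IsPoissonProcess 1 N₁ P)
    (hL : IsStableSubordinator α L P)
    (hindep : IndepFun (fun ω (t : ℝ≥0) => inverseProcess L t ω)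
      (fun ω (t : ℝ≥0) => nonhomPoisson N₁ lam t ω) P) {s t : ℝ≥0} (hst : s ≤ t) {A : Set Ω}
    (hA : MeasurableSet[fnppFiltration hL hN hlam s] A) :
    ∫⁻ ω in A, ((fnpp N₁ lam L t ω - fnpp N₁ lam L s ω : ℕ) : ENNReal) ∂P =
      ∫⁻ ω in A, ENNReal.ofReal (cumRate lam (inverseProcess L t ω) -
        cumRate lam (inverseProcess L s ω)) ∂P := by
  have hAm : MeasurableSet A := (fnppFiltration hL hN hlam).le s A hA
  obtain ⟨B, hB, rfl⟩ := exists_of_measurableSet_historyFiltration hA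
  have hYm := measurable_inverseProcess hL.measurable hL.cadlag
  have hNm : ∀ x, Measurable (nonhomPoisson N₁ lam x) := fun x => hN.measurable _
  have hval : ∀ x ω, rightValue x (fun y => nonhomPoisson N₁ lam y ω) = nonhomPoisson N₁ lam x ω :=
    fun x ω => rightValue_eq (monotone_nonhomPoisson hN hlam ω)
      (rightCont_nonhomPoisson hN hlam ω x)
  have hrv : ∀ u : ℝ≥0, Measurable fun p : (ℝ≥0 → ℝ≥0) × (ℝ≥0 → ℕ) => rightValue (p.1 u) p.2 :=
    fun u => measurable_rightValue.comp (f := fun p : (ℝ≥0 → ℝ≥0) × (ℝ≥0 → ℕ) => (p.1 u, p.2))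
      (((measurable_pi_apply u).comp measurable_fst).prodMk measurable_snd)
  have hZ : Measurable fun p : (ℝ≥0 → ℝ≥0) × (ℝ≥0 → ℕ) =>
      (p.1, fun u : Set.Iic s => rightValue (p.1 u) p.2) :=
    measurable_fst.prodMk (measurable_pi_lambda _ fun u => hrv u)
  -- Both integrands are written as measurable functions of the pair (path of `Y`, path of `N`), so
  -- that Fubini applies.
  set F : (ℝ≥0 → ℝ≥0) × (ℝ≥0 → ℕ) → ENNReal := fun p =>
    B.indicator 1 (p.1, fun u : Set.Iic s => rightValue (p.1 u) p.2) *
      ((rightValue (p.1 t) p.2 - rightValue (p.1 s) p.2 : ℕ) : ENNReal) with hFdef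
  have hF : Measurable F := ((measurable_one.indicator hB).comp hZ).mul
    ((measurable_from_top (f := fun n : ℕ => (n : ENNReal))).comp ((hrv t).sub (hrv s)))
  set G : (ℝ≥0 → ℝ≥0) × (ℝ≥0 → ℕ) → ENNReal := fun p =>
    B.indicator 1 (p.1, fun u : Set.Iic s => rightValue (p.1 u) p.2) *
      ENNReal.ofReal (cumRate lam (p.1 t) - cumRate lam (p.1 s)) with hGdef
  have hcm : ∀ u : ℝ≥0, Measurable fun p : (ℝ≥0 → ℝ≥0) × (ℝ≥0 → ℕ) => cumRate lam (p.1 u) :=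
    fun u => (measurable_cumRate hlam).comp ((measurable_pi_apply u).comp measurable_fst)
  have hGm : Measurable G :=
    ((measurable_one.indicator hB).comp hZ).mul ((hcm t).sub (hcm s)).ennreal_ofReal
  have hfubF := lintegral_of_indepFun hindep (measurable_pi_lambda _ hYm)
    (measurable_pi_lambda _ hNm) hF
  have hfubG := lintegral_of_indepFun hindep (measurable_pi_lambda _ hYm)
    (measurable_pi_lambda _ hNm) hGm
  rw [← lintegral_indicator hAm, ← lintegral_indicator hAm]
  simp only [indicator_preimage_eq_mul]
  simp only [hFdef, hGdef, hval] at hfubF hfubG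
  refine hfubF.trans ((lintegral_congr_ae ?_).trans hfubG.symm)
  -- From here `ω` fixes the clock, and the randomness of `N` is carried by `ω'`.
  filter_upwards [hL.ae_monotone_inverse] with ω hω
  have hi : IndepFun (fun ω' (u : Set.Iic s) => nonhomPoisson N₁ lam (inverseProcess L u ω) ω')
      (fun ω' => nonhomPoisson N₁ lam (inverseProcess L t ω) ω' -
        nonhomPoisson N₁ lam (inverseProcess L s ω) ω') P :=
    -- Monotonicity of the frozen clock puts every observed time before the start of the increment.
    hN.indepFun_past (monotone_time hlam (hω hst)) fun u => monotone_time hlam (hω u.2)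
  have hφ : Measurable fun f : Set.Iic s → ℕ =>
      B.indicator (1 : (ℝ≥0 → ℝ≥0) × (Set.Iic s → ℕ) → ENNReal)
        (fun u => inverseProcess L u ω, f) :=
    (measurable_one.indicator hB).comp measurable_prodMk_left
  have hψ : Measurable fun n : ℕ => (n : ENNReal) := measurable_from_top
  have hφN := hφ.comp
    (measurable_pi_lambda _ fun u : Set.Iic s => hNm (inverseProcess L u ω))
  have hmul := lintegral_mul_eq_lintegral_mul_lintegral_of_indepFun''
    hφN.aemeasurable (hψ.comp ((hNm _).sub (hNm _))).aemeasurable (hi.comp hφ hψ)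
  have hinc := lintegral_nonhomPoisson_increment hN hlam (hω hst)
  simp only [Function.comp_apply, Pi.sub_apply] at hmul hinc
  rw [hinc] at hmul
  exact hmul.trans (lintegral_mul_const _ hφN).symm

/-- The fractional process has the same mean as its compensator. -/
lemma lintegral_fnpp [IsProbabilityMeasure P] (hlam : IsRate lam) (hN : IsPoissonProcess 1 N₁ P)
    (hL : IsStableSubordinator α L P)
    (hindep : IndepFun (fun ω (t : ℝ≥0) => inverseProcess L t ω)
      (fun ω (t : ℝ≥0) => nonhomPoisson N₁ lam t ω) P) (t : ℝ≥0) :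
    ∫⁻ ω, (fnpp N₁ lam L t ω : ENNReal) ∂P =
      ∫⁻ ω, ENNReal.ofReal (cumRate lam (inverseProcess L t ω)) ∂P := by
  have hval : ∀ x ω, rightValue x (fun y => nonhomPoisson N₁ lam y ω) = nonhomPoisson N₁ lam x ω :=
    fun x ω => rightValue_eq (monotone_nonhomPoisson hN hlam ω)
      (rightCont_nonhomPoisson hN hlam ω x)
  have hF : Measurable fun p : (ℝ≥0 → ℝ≥0) × (ℝ≥0 → ℕ) =>
      ((rightValue (p.1 t) p.2 : ℕ) : ENNReal) :=
    (measurable_from_top (f := fun n : ℕ => (n : ENNReal))).comp <|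
      measurable_rightValue.comp (f := fun p : (ℝ≥0 → ℝ≥0) × (ℝ≥0 → ℕ) => (p.1 t, p.2))
        (((measurable_pi_apply t).comp measurable_fst).prodMk measurable_snd)
  have h := lintegral_of_indepFun hindep
    (measurable_pi_lambda _ (measurable_inverseProcess hL.measurable hL.cadlag))
    (measurable_pi_lambda _ fun x => hN.measurable _) hF
  simp only [hval] at h
  refine h.trans (lintegral_congr fun ω => ?_)
  rw [← sub_zero (cumRate lam _), ← cumRate_zero lam,
    ← lintegral_nonhomPoisson_increment hN hlam zero_le]
  refine lintegral_congr_ae ?_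
  filter_upwards [hN.zero] with ω' hω'
  have : nonhomPoisson N₁ lam 0 ω' = 0 := by simpa [nonhomPoisson] using hω'
  rw [this, Nat.sub_zero]

/-- Both processes are nonnegative with equal means, so finiteness passes from the compensator to
the counting process. -/
lemma integrable_fnpp [IsProbabilityMeasure P] (hlam : IsRate lam) (hN : IsPoissonProcess 1 N₁ P)
    (hL : IsStableSubordinator α L P)
    (hindep : IndepFun (fun ω (t : ℝ≥0) => inverseProcess L t ω)
      (fun ω (t : ℝ≥0) => nonhomPoisson N₁ lam t ω) P) {t : ℝ≥0}
    (hint : Integrable (fun ω => cumRate lam (inverseProcess L t ω)) P) :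
    Integrable (fun ω => (fnpp N₁ lam L t ω : ℝ)) P := by
  have hm := measurable_fnpp hN hlam (measurable_inverseProcess hL.measurable hL.cadlag) t
  refine ⟨((measurable_from_top (f := fun n : ℕ => (n : ℝ))).comp hm).aestronglyMeasurable, ?_⟩
  rw [hasFiniteIntegral_iff_ofReal (.of_forall fun ω => Nat.cast_nonneg _)]
  simp only [ENNReal.ofReal_natCast]
  rw [lintegral_fnpp hlam hN hL hindep,
    ← hasFiniteIntegral_iff_ofReal (.of_forall fun ω => cumRate_nonneg hlam _)]
  exact hint.hasFiniteIntegral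

lemma measurable_inverseProcess_initial (hlam : IsRate lam) (hN : IsPoissonProcess 1 N₁ P)
    (hL : IsStableSubordinator α L P) (s t : ℝ≥0) :
    Measurable[fnppFiltration hL hN hlam s] (inverseProcess L t) :=
  Measurable.of_comap_le (le_sup_of_le_left
    (le_iSup (fun u => MeasurableSpace.comap (inverseProcess L u) inferInstance) t))

lemma measurable_fnpp_adapted (hlam : IsRate lam) (hN : IsPoissonProcess 1 N₁ P)
    (hL : IsStableSubordinator α L P) (t : ℝ≥0) :
    Measurable[fnppFiltration hL hN hlam t] (fnpp N₁ lam L t) :=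
  Measurable.of_comap_le (le_sup_of_le_right
    (le_iSup₂ (f := fun u (_ : u ≤ t) => MeasurableSpace.comap (fnpp N₁ lam L u) inferInstance)
      t le_rfl))

/-- All of `Y` is known at time `0`, so right-continuity suffices for predictability;
left-continuity of `Y` is not needed. -/
lemma predictable_cumRate_inverseProcess (hlam : IsRate lam) (hN : IsPoissonProcess 1 N₁ P)
    (hL : IsStableSubordinator α L P) :
    IsStronglyPredictable (fnppFiltration hL hN hlam)
      fun t ω => cumRate lam (inverseProcess L t ω) := by
  have h : Measurable[(inferInstance : MeasurableSpace ℝ≥0).prod (fnppFiltration hL hN hlam 0)]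
      (Function.uncurry (inverseProcess L)) :=
    measurable_uncurry_of_rightCont (fun t => measurable_inverseProcess_initial hlam hN hL 0 t)
      (rightCont_inverseProcess L)
  exact (((measurable_cumRate hlam).comp h).mono (prod_le_predictable _) le_rfl).stronglyMeasurable

lemma martingale_fnpp [IsProbabilityMeasure P] (hlam : IsRate lam) (hN : IsPoissonProcess 1 N₁ P)
    (hL : IsStableSubordinator α L P)
    (hindep : IndepFun (fun ω (t : ℝ≥0) => inverseProcess L t ω)
      (fun ω (t : ℝ≥0) => nonhomPoisson N₁ lam t ω) P)
    (hint : ∀ t : ℝ≥0, Integrable (fun ω => cumRate lam (inverseProcess L t ω)) P) :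
    Martingale (fun t ω => (fnpp N₁ lam L t ω : ℝ) - cumRate lam (inverseProcess L t ω))
      (fnppFiltration hL hN hlam) P := by
  set X : ℝ≥0 → Ω → ℝ := fun t ω => (fnpp N₁ lam L t ω : ℝ) with hX
  set A : ℝ≥0 → Ω → ℝ := fun t ω => cumRate lam (inverseProcess L t ω) with hA
  have hXi : ∀ t, Integrable (X t) P := fun t => integrable_fnpp hlam hN hL hindep (hint t)
  have hadapted : ∀ t, StronglyMeasurable[fnppFiltration hL hN hlam t] fun ω => X t ω - A t ω :=
    fun t => (((measurable_from_top (f := fun n : ℕ => (n : ℝ))).comp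
      (measurable_fnpp_adapted hlam hN hL t)).sub ((measurable_cumRate hlam).comp
        (measurable_inverseProcess_initial hlam hN hL t t))).stronglyMeasurable
  refine ⟨hadapted, fun s t hst => ?_⟩
  refine (ae_eq_condExp_of_forall_setIntegral_eq ((fnppFiltration hL hN hlam).le s)
    ((hXi t).sub (hint t)) (fun S _ _ => ((hXi s).sub (hint s)).integrableOn) (fun S hS _ => ?_)
    (hadapted s).aestronglyMeasurable).symm
  have hmono : ∀ᵐ ω ∂P.restrict S, Monotone fun t => inverseProcess L t ω :=
    ae_restrict_of_ae hL.ae_monotone_inverse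
  have hX0 : 0 ≤ᵐ[P.restrict S] fun ω => X t ω - X s ω := by
    filter_upwards [hmono] with ω hω
    exact sub_nonneg.2 (Nat.cast_le.2 (monotone_nonhomPoisson hN hlam ω (hω hst)))
  have hA0 : 0 ≤ᵐ[P.restrict S] fun ω => A t ω - A s ω := by
    filter_upwards [hmono] with ω hω
    exact sub_nonneg.2 (monotone_cumRate hlam (hω hst))
  -- Both increments are almost surely nonnegative, so the identity of `ENNReal`-valued integrals
  -- transfers to real ones; monotonicity also makes the truncated subtraction in `ℕ` exact.
  have hincr : ∫ ω in S, (X t ω - X s ω) ∂P = ∫ ω in S, (A t ω - A s ω) ∂P := by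
    rw [integral_eq_lintegral_of_nonneg_ae hX0 ((hXi t).sub (hXi s)).1.restrict,
      integral_eq_lintegral_of_nonneg_ae hA0 ((hint t).sub (hint s)).1.restrict,
      ← setLIntegral_fnpp_increment hlam hN hL hindep hst hS]
    congr 1
    refine lintegral_congr_ae ?_
    filter_upwards [hmono] with ω hω
    have hle : fnpp N₁ lam L s ω ≤ fnpp N₁ lam L t ω := monotone_nonhomPoisson hN hlam ω (hω hst)
    rw [← ENNReal.ofReal_natCast, Nat.cast_sub hle]
  have h1 := integral_sub (hXi t).integrableOn (hXi s).integrableOn (μ := P.restrict S)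
  have h2 := integral_sub (hint t).integrableOn (hint s).integrableOn (μ := P.restrict S)
  have h3 := integral_sub (hXi t).integrableOn (hint t).integrableOn (μ := P.restrict S)
  have h4 := integral_sub (hXi s).integrableOn (hint s).integrableOn (μ := P.restrict S)
  refine h4.trans (Eq.trans ?_ h3.symm)
  linarith

end Main

end FNPP

theorem mainTheorem6 {Ω : Type*} {m : MeasurableSpace Ω} (P : Measure Ω) [IsProbabilityMeasure P]
    (α : ℝ) (hα : 0 < α ∧ α < 1)
    (lam : ℝ → ℝ) (hlam : FNPP.IsRate lam)
    (N₁ : ℝ≥0 → Ω → ℕ) (hN : FNPP.IsPoissonProcess 1 N₁ P)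
    (L : ℝ≥0 → Ω → ℝ) (hL : FNPP.IsStableSubordinator α L P)
    (hindep : IndepFun (fun ω (t : ℝ≥0) => FNPP.inverseProcess L t ω)
      (fun ω (t : ℝ≥0) => FNPP.nonhomPoisson N₁ lam t ω) P)
    (hint : ∀ t : ℝ≥0, Integrable (fun ω => FNPP.cumRate lam (FNPP.inverseProcess L t ω)) P) :
    FNPP.IsCompensator (fun t ω => (FNPP.fnpp N₁ lam L t ω : ℝ))
        (fun t ω => FNPP.cumRate lam (FNPP.inverseProcess L t ω))
        (FNPP.fnppFiltration hL hN hlam) P ∧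
      Martingale
        (fun t ω => (FNPP.nonhomPoisson N₁ lam (FNPP.inverseProcess L t ω) ω : ℝ) -
          FNPP.cumRate lam (FNPP.inverseProcess L t ω))
        (FNPP.fnppFiltration hL hN hlam) P := by
  have hmart := FNPP.martingale_fnpp hlam hN hL hindep hint
  -- `fnpp` unfolds to `nonhomPoisson` at the inverse time, so one proof serves both martingale
  -- claims.
  refine ⟨⟨FNPP.predictable_cumRate_inverseProcess hlam hN hL, ?_, ?_, ?_, hmart⟩, hmart⟩
  · filter_upwards [hL.ae_inverse_zero hα.1] with ω hω
    rw [hω, FNPP.cumRate_zero]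
  · filter_upwards [hL.ae_monotone_inverse] with ω hω
    exact (FNPP.monotone_cumRate hlam).comp hω
  · refine .of_forall fun ω t => ?_
    exact (FNPP.continuous_cumRate hlam).continuousAt.comp_continuousWithinAt
      (FNPP.rightCont_inverseProcess L ω t)
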